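/- Let $d\ge 1$, $\mathbb{E}^d=(0,\infty)^d$ with topological boundary $\mathcal{O}^d=\partial\mathbb{E}^d$, and $\min(\mathbf{z})=\min\{z_1,\dots,z_d\}$ for $\mathbf z\in\mathbb R^d$. A random vector $\mathbf{Z}\in\mathbb{R}^d$ is called regularly varying on $\mathbb{E}^d$ with index $-\alpha$ ($\alpha>0$) and limit measure $\nu$ if $\nu\neq 0$ is a Borel measure on $\mathbb{E}^d$ that is finite on $(s,\infty)^d$ for all $s>0$, that is homogeneous of order $-\alpha$ (that is, $\nu(tB)=t^{-\alpha}\nu(B)$ for all $t>0$ and all Borel sets $B\subset\mathbb{E}^d$), and that satisfies $$\lim_{x\to\infty}\frac{P(\mathbf{Z}\in xB)}{P(\min(\mathbf{Z})>x)}=\nu(B)$$ for all Borel sets $B\subset\mathbb{E}^d$ bounded away from $\mathcal{O}^d$ with $\nu(\partial B)=0$. For $\mathbf{A}\in\mathbb{R}^{d\times d}$ let $$\tau(\mathbf{A})=\sup\{\min((\mathbf{A}\mathbf{x})^+) : \mathbf{x}\in\mathbb{E}^d,\ \min(\mathbf{x})=1\}\in[0,\infty],$$ where $(\cdot)^+$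 is the componentwise positive part, and for $B\subset\mathbb{R}^d$ let $\mathbf{A}^{-1}B$ be the preimage of $B$ under $\mathbf{x}\mapsto\mathbf{A}\mathbf{x}$. **Theorem.** Let $\mathbf{Z}$ be regularly varying on $\mathbb{E}^d$ with index $-\alpha$, $\alpha>0$, and limit measure $\nu$ (regarded as a measure on $\mathbb R^d$ with $\nu(\mathbb R^d\setminus\mathbb E^d)=0$). Let $\mathbf{A}$ be a random $d\times d$ real matrix, independent of $\mathbf{Z}$, with $\tau(\mathbf{A})>0$ almost surely and $E(\tau(\mathbf{A})^{\alpha+\delta})<\infty$ for some $\delta>0$. Then $$\lim_{x\to\infty}\frac{P(\mathbf{A}\mathbf{Z}\in xB)}{P(\min(\mathbf{Z})>x)}=E(\nu(\mathbf{A}^{-1}B))<\infty$$ for all Borel sets $B\subset\mathbb{E}^d$ bounded away from $\mathcal{O}^d$ with $E(\nu(\partial(\mathbf{A}^{-1}B)))=0$. In particular, if $E(\nu(\mathbf{A}^{-1}(1,\infty)^d))>0$, then $\mathbf{A}\mathbf{Z}$ is regularly varying on $\mathbb{E}^d$ with index $-\alpha$ and limit measure $$B\mapsto\frac{E(\nu(\mathbf{A}^{-1}B))}{E(\nu(\mathbf{A}^{-1}(1,\infty)^d))}.$$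 -/

import Mathlib

open MeasureTheory ProbabilityTheory Filter Topology
open scoped ENNReal Pointwise Matrix

namespace ConeRV

/-- The (entrywise) Borel sigma-algebra on real matrices. -/
instance instMeasurableSpaceMatrix (d : ℕ) : MeasurableSpace (Matrix (Fin d) (Fin d) ℝ) :=
  inferInstanceAs (MeasurableSpace (Fin d → Fin d → ℝ))

/-- The open cone `(0, ∞)^d`. -/
def cone (d : ℕ) : Set (Fin d → ℝ) := {x | ∀ i, 0 < x i}

/-- The smallest coordinate `min {z_1, …, z_d}` (used for `d ≥ 1`). -/
noncomputable def minCoord {d : ℕ} (z : Fin d → ℝ) : ℝ := ⨅ i, z i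

/-- The box `(s, ∞)^d`. -/
def upperBox (d : ℕ) (s : ℝ) : Set (Fin d → ℝ) := {x | ∀ i, s < x i}

/-- `B` is bounded away from the topological boundary of the cone `(0, ∞)^d`. -/
def BoundedAwayFromBoundary {d : ℕ} (B : Set (Fin d → ℝ)) : Prop :=
  ∃ ε : ℝ, 0 < ε ∧ ∀ x ∈ B, ∀ y ∈ frontier (cone d), ε ≤ dist x y

/-- `τ(A) = sup {min ((A x)⁺) : x ∈ (0, ∞)^d, min x = 1}`, with values in `[0, ∞]`. -/
noncomputable def tau {d : ℕ} (A : Matrix (Fin d) (Fin d) ℝ) : ℝ≥0∞ :=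
  ⨆ x ∈ {x : Fin d → ℝ | x ∈ cone d ∧ minCoord x = 1},
    ENNReal.ofReal (minCoord fun i => max ((A *ᵥ x) i) 0)

/-- The random vector `Z` is regularly varying on the cone `(0, ∞)^d` with index `-α` and limit
measure `ν`. A measure on the Borel sets of the cone is represented by its extension by zero to
the Borel sets of `ℝ^d`. For sets bounded away from the boundary of the cone, the topological
boundary relative to the cone and the one in `ℝ^d` agree. -/
structure IsRegularlyVarying {Ω : Type*} [MeasurableSpace Ω] {d : ℕ} (P : Measure Ω)
    (Z : Ω → Fin d → ℝ) (α : ℝ) (ν : Measure (Fin d → ℝ)) : Prop where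
  compl_cone : ν (cone d)ᶜ = 0
  ne_zero : ν ≠ 0
  finite_upperBox : ∀ s : ℝ, 0 < s → ν (upperBox d s) < ∞
  tendsto : ∀ B : Set (Fin d → ℝ), MeasurableSet B → B ⊆ cone d → BoundedAwayFromBoundary B →
    ν (frontier B) = 0 →
    Tendsto (fun x : ℝ => P {ω | Z ω ∈ x • B} / P {ω | x < minCoord (Z ω)}) atTop (𝓝 (ν B))
  index_pos : 0 < α
  homogeneous : ∀ t : ℝ, 0 < t → ∀ B : Set (Fin d → ℝ), MeasurableSet B → B ⊆ cone d →
    ν (t • B) = ENNReal.ofReal (t ^ (-α)) * ν B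

/-- `E (ν (A⁻¹ B))`, where `A⁻¹ B` is the preimage of `B` under the random matrix `A`. -/
noncomputable def meanPreimage {Ω : Type*} [MeasurableSpace Ω] {d : ℕ} (P : Measure Ω)
    (A : Ω → Matrix (Fin d) (Fin d) ℝ) (ν : Measure (Fin d → ℝ)) (B : Set (Fin d → ℝ)) : ℝ≥0∞ :=
  ∫⁻ ω, ν ((fun z => A ω *ᵥ z) ⁻¹' B) ∂P

end ConeRV

/-! Condition on `A`. For fixed `A` with `0 < tau A < ∞`, the preimage of a set inside `(ε,∞)^d`
lies in `(ε/τ,∞)^d`, so regular variation of `Z` applies to it and gives convergence to `ν (A⁻¹B)`.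
The Potter bound with `p = α + δ` dominates the conditional ratios by a constant times `1 + ε^(-p)
τ^p`, which is integrable. Independence and dominated convergence then give the limit.

As `Z` may leave the cone, the crux is `mem_cone_of_mulVec_mem_cone`: `A` sends no point outside the
cone into it. This also forces `A` to be invertible, so frontiers commute with preimages. -/

namespace ConeRV

/-! ### Boxes and sets bounded away from the boundary of the cone. -/

section Cone

variable {d : ℕ}

lemma isOpen_upperBox (s : ℝ) : IsOpen (upperBox d s) := by
  have : upperBox d s = ⋂ i, {x | s < x i} := by ext; simp [upperBox]
  rw [this]
  exact isOpen_iInter_of_finite fun i => isOpen_lt continuous_const (continuous_apply i)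

lemma cone_eq_upperBox : cone d = upperBox d 0 := rfl

lemma isOpen_cone : IsOpen (cone d) := isOpen_upperBox 0

lemma upperBox_subset {s t : ℝ} (h : s ≤ t) : upperBox d t ⊆ upperBox d s :=
  fun _ hx i => h.trans_lt (hx i)

lemma convex_upperBox (s : ℝ) : Convex ℝ (upperBox d s) := by
  have : upperBox d s = ⋂ i, {x | s < x i} := by ext; simp [upperBox]
  rw [this]
  exact convex_iInter fun i => convex_halfSpace_gt
    (IsLinearMap.mk (fun _ _ => rfl) fun _ _ => rfl) s

lemma isClosed_closedBox (s : ℝ) : IsClosed {x : Fin d → ℝ | ∀ i, s ≤ x i} := by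
  have : {x : Fin d → ℝ | ∀ i, s ≤ x i} = ⋂ i, {x | s ≤ x i} := by ext; simp
  rw [this]
  exact isClosed_iInter fun i => isClosed_le continuous_const (continuous_apply i)

lemma closure_upperBox_subset (s : ℝ) : closure (upperBox d s) ⊆ {x | ∀ i, s ≤ x i} :=
  closure_minimal (fun _ hx i => (hx i).le) (isClosed_closedBox s)

lemma smul_upperBox {t : ℝ} (ht : 0 < t) (s : ℝ) : t • upperBox d s = upperBox d (t * s) := by
  ext x
  rw [Set.mem_smul_set_iff_inv_smul_mem₀ ht.ne']
  refine forall_congr' fun i => ?_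
  rw [Pi.smul_apply, smul_eq_mul, lt_inv_mul_iff₀ ht]

lemma exists_mem_upperBox {x : Fin d → ℝ} (hx : x ∈ cone d) : ∃ s, 0 < s ∧ x ∈ upperBox d s := by
  rcases isEmpty_or_nonempty (Fin d) with h | h
  · exact ⟨1, one_pos, fun i => h.elim i⟩
  · obtain ⟨i, hi⟩ := exists_eq_ciInf_of_finite (f := x)
    refine ⟨x i / 2, half_pos (hx i), fun j => (half_lt_self (hx i)).trans_le ?_⟩
    rw [hi]
    exact ciInf_le (Set.finite_range x).bddBelow j

lemma lt_minCoord_iff [Nonempty (Fin d)] {s : ℝ} {x : Fin d → ℝ} :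
    s < minCoord x ↔ x ∈ upperBox d s := by
  constructor
  · exact fun h i => h.trans_le (ciInf_le (Set.finite_range x).bddBelow i)
  · intro h
    obtain ⟨i, hi⟩ := exists_eq_ciInf_of_finite (f := x)
    rw [minCoord, ← hi]
    exact h i

lemma setOf_mem_smul_upperBox [Nonempty (Fin d)] {Ω : Type*} (Z : Ω → Fin d → ℝ) {x : ℝ}
    (hx : 0 < x) (t : ℝ) :
    {ω | Z ω ∈ x • upperBox d t} = {ω | x * t < minCoord (Z ω)} := by
  ext ω
  simp only [Set.mem_ofPred_eq]
  rw [smul_upperBox hx, lt_minCoord_iff]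

lemma frontier_subset_cone {B : Set (Fin d → ℝ)} {ε : ℝ} (hε : 0 < ε) (hB : B ⊆ upperBox d ε) :
    frontier B ⊆ cone d := fun _ hx i =>
  hε.trans_le (closure_upperBox_subset ε (closure_mono hB (frontier_subset_closure hx)) i)

/-- Setting one coordinate of `x` to zero gives a boundary point at sup-distance `x i`. Halving `ε`
makes the inequality strict. -/
lemma BoundedAwayFromBoundary.exists_subset_upperBox {B : Set (Fin d → ℝ)} (hB : B ⊆ cone d)
    (h : BoundedAwayFromBoundary B) : ∃ ε, 0 < ε ∧ B ⊆ upperBox d ε := by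
  obtain ⟨ε, hε, h⟩ := h
  refine ⟨ε / 2, half_pos hε, fun x hx i => (half_lt_self hε).trans_le ?_⟩
  have hy : Function.update x i 0 ∈ frontier (cone d) := by
    rw [isOpen_cone.frontier_eq]
    refine ⟨?_, fun hc => by simpa using hc i⟩
    have ht : Tendsto (fun t : ℝ => Function.update x i t) (𝓝[>] 0)
        (𝓝 (Function.update x i 0)) := by
      have hc : Continuous fun t : ℝ => Function.update x i t :=
        continuous_const.update i continuous_id
      exact (hc.tendsto 0).mono_left nhdsWithin_le_nhds
    refine mem_closure_of_tendsto ht ?_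
    filter_upwards [self_mem_nhdsWithin] with t (hpos : 0 < t) j
    rcases eq_or_ne j i with rfl | hj
    · simpa using hpos
    · simpa [hj] using hB hx j
  refine (h x hx _ hy).trans ?_
  refine (dist_pi_le_iff (hB hx i).le).2 fun j => ?_
  rcases eq_or_ne j i with rfl | hj
  · simp [abs_of_pos (hB hx j)]
  · simpa [hj] using (hB hx i).le

lemma boundedAwayFromBoundary_of_subset_upperBox {B : Set (Fin d → ℝ)} {ε : ℝ} (hε : 0 < ε)
    (hB : B ⊆ upperBox d ε) : BoundedAwayFromBoundary B := by
  refine ⟨ε, hε, fun x hx y hy => ?_⟩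
  rw [isOpen_cone.frontier_eq] at hy
  have := hy.2
  simp only [cone, Set.mem_ofPred_eq, not_forall, not_lt] at this
  obtain ⟨i, hi⟩ := this
  refine le_trans ?_ (dist_le_pi_dist x y i)
  rw [Real.dist_eq]
  have := hB hx i
  exact le_trans (by linarith) (le_abs_self _)

lemma iUnion_upperBox_eq_cone : ⋃ n : ℕ, upperBox d (1 / ((n : ℝ) + 1)) = cone d := by
  ext x
  simp only [Set.mem_iUnion]
  constructor
  · rintro ⟨n, hn⟩
    exact upperBox_subset (by positivity) hn
  · intro hx
    obtain ⟨s, hs, hxs⟩ := exists_mem_upperBox hx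
    obtain ⟨n, hn⟩ := exists_nat_one_div_lt hs
    exact ⟨n, upperBox_subset hn.le hxs⟩

end Cone

/-! ### Deterministic matrices with `0 < tau A < ∞`. -/

section Tau

variable {d : ℕ} {A : Matrix (Fin d) (Fin d) ℝ}

lemma continuous_minCoord [Nonempty (Fin d)] : Continuous (minCoord : (Fin d → ℝ) → ℝ) := by
  have : (minCoord : (Fin d → ℝ) → ℝ) =
      fun z => Finset.univ.inf' Finset.univ_nonempty fun i => z i := by
    ext z
    rw [Finset.inf'_univ_eq_ciInf]
    rfl
  rw [this]
  exact Continuous.finset_inf'_apply _ fun i _ => continuous_apply i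

/-- The supremum is uncountable, but lower semicontinuity in the entries survives it. -/
lemma measurable_tau [Nonempty (Fin d)] :
    Measurable (tau : Matrix (Fin d) (Fin d) ℝ → ℝ≥0∞) := by
  have : LowerSemicontinuous fun B : Fin d → Fin d → ℝ => tau (Matrix.of B) := by
    refine lowerSemicontinuous_biSup fun x _ => Continuous.lowerSemicontinuous ?_
    refine ENNReal.continuous_ofReal.comp (continuous_minCoord.comp ?_)
    refine continuous_pi fun i => Continuous.max ?_ continuous_const
    simp only [Matrix.mulVec, dotProduct, Matrix.of_apply]
    fun_prop
  exact this.measurable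

lemma exists_mulVec_mem_cone [Nonempty (Fin d)] (h : 0 < tau A) :
    ∃ x ∈ cone d, A *ᵥ x ∈ cone d := by
  obtain ⟨x, hx⟩ := lt_iSup_iff.1 h
  obtain ⟨hx, h⟩ := lt_iSup_iff.1 hx
  refine ⟨x, hx.1, fun i => ?_⟩
  have := lt_minCoord_iff.1 (ENNReal.ofReal_pos.1 h) i
  simpa using this

/-- Dividing `x` by its smallest coordinate makes it a competitor in the supremum defining `tau A`.
-/
lemma lt_tau_mul [Nonempty (Fin d)] (hfin : tau A ≠ ∞) {s : ℝ} (hs : 0 ≤ s) {x : Fin d → ℝ}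
    (hx : x ∈ cone d) (hAx : A *ᵥ x ∈ upperBox d s) (i : Fin d) : s < (tau A).toReal * x i := by
  obtain ⟨k, hk⟩ := exists_eq_ciInf_of_finite (f := x)
  have hmin : ∀ j, x k ≤ x j := fun j => by
    rw [hk]; exact ciInf_le (Set.finite_range x).bddBelow j
  have hpos := hx k
  by_contra! hle
  have hlt : ENNReal.ofReal (s / x k) < tau A := by
    have hy : (x k)⁻¹ • x ∈ {x : Fin d → ℝ | x ∈ cone d ∧ minCoord x = 1} := by
      refine ⟨fun j => mul_pos (inv_pos.2 hpos) (hx j), ?_⟩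
      refine le_antisymm ?_ ?_
      · refine (ciInf_le (Set.finite_range _).bddBelow k).trans ?_
        simp [hpos.ne']
      · refine le_ciInf fun j => ?_
        rw [Pi.smul_apply, smul_eq_mul, le_inv_mul_iff₀ hpos]
        simpa using hmin j
    refine lt_of_lt_of_le ?_ (le_iSup₂ (f := fun (x : Fin d → ℝ)
      (_ : x ∈ {x : Fin d → ℝ | x ∈ cone d ∧ minCoord x = 1}) =>
      ENNReal.ofReal (minCoord fun i => max ((A *ᵥ x) i) 0)) _ hy)
    have hlt : s / x k < minCoord fun i => max ((A *ᵥ ((x k)⁻¹ • x)) i) 0 := by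
      rw [lt_minCoord_iff]
      intro j
      refine lt_max_of_lt_left ?_
      rw [Matrix.mulVec_smul, Pi.smul_apply, smul_eq_mul, lt_inv_mul_iff₀ hpos,
        mul_div_cancel₀ _ hpos.ne']
      exact hAx j
    exact (ENNReal.ofReal_lt_ofReal_iff_of_nonneg (by positivity)).2 hlt
  have h1 : s / x k < (tau A).toReal := (ENNReal.ofReal_lt_iff_lt_toReal (by positivity) hfin).1 hlt
  rw [div_lt_iff₀ hpos] at h1
  have := mul_le_mul_of_nonneg_left (hmin i) (ENNReal.toReal_nonneg (a := tau A))
  linarith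

/-- A connectedness argument: the convex set `S` meets the cone in a relatively open set. It is
relatively closed too, because `lt_tau_mul` keeps its coordinates above `s / τ`, so no limit point
in `S` reaches the boundary. -/
lemma mem_cone_of_mulVec_mem_cone [Nonempty (Fin d)] (h : 0 < tau A) (hfin : tau A ≠ ∞)
    {z : Fin d → ℝ} (hz : A *ᵥ z ∈ cone d) : z ∈ cone d := by
  obtain ⟨x, hx, hAx⟩ := exists_mulVec_mem_cone h
  obtain ⟨s₁, hs₁, hx₁⟩ := exists_mem_upperBox hAx
  obtain ⟨s₂, hs₂, hz₂⟩ := exists_mem_upperBox hz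
  set s := min s₁ s₂
  have hs : 0 < s := lt_min hs₁ hs₂
  set S : Set (Fin d → ℝ) := A.mulVecLin ⁻¹' upperBox d s
  have hconv : Convex ℝ S := (convex_upperBox s).linear_preimage A.mulVecLin
  have hcont : Continuous A.mulVecLin := LinearMap.continuous_of_finiteDimensional _
  have hT : 0 < (tau A).toReal := ENNReal.toReal_pos h.ne' hfin
  have hxS : x ∈ S := upperBox_subset (min_le_left _ _) hx₁
  have hzS : z ∈ S := upperBox_subset (min_le_right _ _) hz₂
  have hu : IsOpen (cone d ∩ S) := isOpen_cone.inter ((isOpen_upperBox s).preimage hcont)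
  refine (hconv.isPreconnected.subset_of_closure_inter_subset hu ⟨x, hxS, hx, hxS⟩ ?_ hzS).1
  rintro w ⟨hw, hwS⟩
  refine ⟨fun i => ?_, hwS⟩
  have hsub : cone d ∩ S ⊆ {w | ∀ i, s / (tau A).toReal ≤ w i} := fun v hv i => by
    rw [Set.mem_inter_iff] at hv
    rw [div_le_iff₀' hT]
    exact (lt_tau_mul hfin hs.le hv.1 hv.2 i).le
  exact (div_pos hs hT).trans_le (closure_minimal hsub (isClosed_closedBox _) hw i)

lemma preimage_mulVec_subset_upperBox [Nonempty (Fin d)] (h : 0 < tau A) (hfin : tau A ≠ ∞)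
    {B : Set (Fin d → ℝ)} {s : ℝ} (hs : 0 < s) (hB : B ⊆ upperBox d s) :
    (fun z => A *ᵥ z) ⁻¹' B ⊆ upperBox d (s / (tau A).toReal) := fun z hz i => by
  have hz : A *ᵥ z ∈ upperBox d s := hB hz
  rw [div_lt_iff₀' (ENNReal.toReal_pos h.ne' hfin)]
  exact lt_tau_mul hfin hs.le (mem_cone_of_mulVec_mem_cone h hfin (upperBox_subset hs.le hz)) hz i

lemma frontier_preimage_mulVec [Nonempty (Fin d)] (h : 0 < tau A) (hfin : tau A ≠ ∞)
    (B : Set (Fin d → ℝ)) :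
    frontier ((fun z => A *ᵥ z) ⁻¹' B) = (fun z => A *ᵥ z) ⁻¹' frontier B := by
  obtain ⟨x, -, hAx⟩ := exists_mulVec_mem_cone h
  have hinj : Function.Injective A.mulVecLin := by
    rw [injective_iff_map_eq_zero]
    intro z hz
    by_contra hne
    obtain ⟨i, hi⟩ := Function.ne_iff.1 hne
    -- Moving `x` along a kernel vector until coordinate `i` vanishes leaves its image in the cone,
    -- a contradiction.
    have := mem_cone_of_mulVec_mem_cone h hfin (z := x + (-x i / z i) • z) (by
      rw [Matrix.mulVec_add, Matrix.mulVec_smul]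
      rw [Matrix.mulVecLin_apply] at hz
      simpa [hz] using hAx) i
    simp only [Pi.zero_apply] at hi
    simp [hi] at this
  have hopen := A.mulVecLin.isOpenMap_of_finiteDimensional
    (LinearMap.injective_iff_surjective.1 hinj)
  exact (hopen.preimage_frontier_eq_frontier_preimage
    (LinearMap.continuous_of_finiteDimensional _) B).symm

lemma preimage_mulVec_smul (A : Matrix (Fin d) (Fin d) ℝ) {t : ℝ} (ht : t ≠ 0)
    (B : Set (Fin d → ℝ)) :
    (fun z => A *ᵥ z) ⁻¹' (t • B) = t • ((fun z => A *ᵥ z) ⁻¹' B) := by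
  ext z
  simp [Set.mem_smul_set_iff_inv_smul_mem₀ ht, Matrix.mulVec_smul]

lemma measurable_mulVec_prod :
    Measurable fun p : Matrix (Fin d) (Fin d) ℝ × (Fin d → ℝ) => p.1 *ᵥ p.2 := by
  refine measurable_pi_lambda _ fun i => ?_
  simp only [Matrix.mulVec, dotProduct]
  refine Finset.measurable_sum _ fun j _ => Measurable.mul ?_ ?_
  · have h : Measurable fun B : Fin d → Fin d → ℝ => B i j :=
      (measurable_pi_apply j).comp (measurable_pi_apply i)
    exact Measurable.comp (β := Matrix (Fin d) (Fin d) ℝ) h measurable_fst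
  · exact (measurable_pi_apply j).comp measurable_snd

lemma measurable_mulVec (A : Matrix (Fin d) (Fin d) ℝ) : Measurable fun z => A *ᵥ z :=
  measurable_mulVec_prod.comp measurable_prodMk_left

end Tau

/-! ### Consequences of homogeneity of the limit measure. -/

section Homogeneous

variable {d : ℕ} {α : ℝ} {ν : Measure (Fin d → ℝ)}

lemma measure_upperBox (hhom : ∀ t : ℝ, 0 < t → ∀ B : Set (Fin d → ℝ), MeasurableSet B →
      B ⊆ cone d → ν (t • B) = ENNReal.ofReal (t ^ (-α)) * ν B) {t : ℝ} (ht : 0 < t) :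
    ν (upperBox d t) = ENNReal.ofReal (t ^ (-α)) * ν (upperBox d 1) := by
  rw [← hhom t ht _ (isOpen_upperBox 1).measurableSet (upperBox_subset zero_le_one),
    smul_upperBox ht, mul_one]

/-- The closed box lies in every open box with `s < t`, whose measure is continuous in `s`. -/
lemma measure_frontier_upperBox (hfin : ∀ s : ℝ, 0 < s → ν (upperBox d s) < ∞)
    (hhom : ∀ t : ℝ, 0 < t → ∀ B : Set (Fin d → ℝ), MeasurableSet B →
      B ⊆ cone d → ν (t • B) = ENNReal.ofReal (t ^ (-α)) * ν B) {t : ℝ} (ht : 0 < t) :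
    ν (frontier (upperBox d t)) = 0 := by
  have hle : ν (closure (upperBox d t)) ≤ ν (upperBox d t) := by
    have hlim : Tendsto (fun s : ℝ => ENNReal.ofReal (s ^ (-α)) * ν (upperBox d 1)) (𝓝[<] t)
        (𝓝 (ENNReal.ofReal (t ^ (-α)) * ν (upperBox d 1))) := by
      refine ENNReal.Tendsto.mul_const (ENNReal.tendsto_ofReal ?_) (Or.inr (hfin 1 one_pos).ne)
      exact ((Real.continuousAt_rpow_const t (-α) (Or.inl ht.ne')).tendsto).mono_left
        nhdsWithin_le_nhds
    rw [measure_upperBox hhom ht]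
    refine ge_of_tendsto hlim ?_
    filter_upwards [Ioo_mem_nhdsLT ht] with s hs
    rw [← measure_upperBox hhom hs.1]
    exact measure_mono fun x hx i => hs.2.trans_le (closure_upperBox_subset t hx i)
  rw [(isOpen_upperBox t).frontier_eq, measure_sdiff subset_closure
    (isOpen_upperBox t).measurableSet.nullMeasurableSet (hfin t ht).ne]
  exact tsub_eq_zero_of_le hle

lemma sigmaFinite_of_upperBox (hc : ν (cone d)ᶜ = 0)
    (hfin : ∀ s : ℝ, 0 < s → ν (upperBox d s) < ∞) : SigmaFinite ν := by
  refine ⟨⟨⟨fun n => upperBox d (1 / ((n : ℝ) + 1)) ∪ (cone d)ᶜ, fun _ => trivial, fun n => ?_,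
    ?_⟩⟩⟩
  · refine (measure_union_le _ _).trans_lt ?_
    rw [hc, add_zero]
    exact hfin _ (by positivity)
  · rw [← Set.iUnion_union, iUnion_upperBox_eq_cone, Set.union_compl_self]

end Homogeneous

end ConeRV

namespace ConeRV

/-! ### Tail of `min Z` and the Potter bound. -/

section RegularVariation

variable {Ω : Type*} [MeasurableSpace Ω] {P : Measure Ω} {d : ℕ}
  [Nonempty (Fin d)] {Z : Ω → Fin d → ℝ} {α : ℝ} {ν : Measure (Fin d → ℝ)}

lemma IsRegularlyVarying.tendsto_upperBox (h : IsRegularlyVarying P Z α ν) {t : ℝ} (ht : 0 < t) :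
    Tendsto (fun x : ℝ => P {ω | x * t < minCoord (Z ω)} / P {ω | x < minCoord (Z ω)}) atTop
      (𝓝 (ν (upperBox d t))) := by
  refine (h.tendsto _ (isOpen_upperBox t).measurableSet (upperBox_subset ht.le)
    (boundedAwayFromBoundary_of_subset_upperBox ht subset_rfl)
    (measure_frontier_upperBox h.finite_upperBox h.homogeneous ht)).congr' ?_
  filter_upwards [eventually_gt_atTop 0] with x hx
  rw [setOf_mem_smul_upperBox Z hx]

/-- Otherwise the ratios are eventually `0 / 0 = 0`, and `ν` vanishes on every box, hence
everywhere. -/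
lemma IsRegularlyVarying.measure_lt_ne_zero (h : IsRegularlyVarying P Z α ν) (x : ℝ) :
    P {ω | x < minCoord (Z ω)} ≠ 0 := by
  intro h0
  have hbox : ∀ t : ℝ, 0 < t → ν (upperBox d t) = 0 := by
    intro t ht
    refine tendsto_nhds_unique (h.tendsto_upperBox ht) (tendsto_const_nhds.congr' ?_)
    filter_upwards [(tendsto_id.atTop_mul_const ht).eventually_ge_atTop x] with y hy
    have : P {ω | y * t < minCoord (Z ω)} = 0 :=
      measure_mono_null (fun ω hω => lt_of_le_of_lt hy hω) h0
    rw [this, ENNReal.zero_div]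
  refine h.ne_zero (Measure.measure_univ_eq_zero.1 ?_)
  rw [← Set.union_compl_self (cone d), ← iUnion_upperBox_eq_cone]
  refine measure_union_null (measure_iUnion_null fun n => hbox _ (by positivity)) ?_
  rw [iUnion_upperBox_eq_cone]
  exact h.compl_cone

lemma IsRegularlyVarying.measure_upperBox_one [IsProbabilityMeasure P]
    (h : IsRegularlyVarying P Z α ν) :
    ν (upperBox d 1) = 1 := by
  refine tendsto_nhds_unique (h.tendsto_upperBox one_pos) (tendsto_const_nhds.congr fun x => ?_)
  rw [mul_one, ENNReal.div_self (h.measure_lt_ne_zero x) (measure_ne_top _ _)]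

/-- A one-sided Potter bound for the tail of `min Z`. -/
lemma IsRegularlyVarying.exists_potter_bound [IsProbabilityMeasure P]
    (h : IsRegularlyVarying P Z α ν) {p : ℝ}
    (hp : α < p) : ∃ C : ℝ≥0∞, C ≠ ∞ ∧ ∃ x₀ : ℝ, 0 < x₀ ∧ ∀ x, x₀ ≤ x → ∀ s, 0 < s →
      P {ω | x * s < minCoord (Z ω)} / P {ω | x < minCoord (Z ω)} ≤
        C * (1 + ENNReal.ofReal (s ^ (-p))) := by
  set G : ℝ → ℝ≥0∞ := fun x => P {ω | x < minCoord (Z ω)} with hG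
  have hG0 : ∀ x, G x ≠ 0 := h.measure_lt_ne_zero
  have hGt : ∀ x, G x ≠ ∞ := fun x => measure_ne_top _ _
  have hanti : Antitone G := fun x y hxy => measure_mono fun ω hω => lt_of_le_of_lt hxy hω
  have hp0 : 0 < p := h.index_pos.trans hp
  -- Halving the threshold costs asymptotically `2 ^ α`, hence at most `2 ^ p` beyond some `x₀`.
  set M : ℝ≥0∞ := ENNReal.ofReal (2 ^ p) with hM
  have hM1 : 1 ≤ M := by
    rw [hM, ← ENNReal.ofReal_one]
    exact ENNReal.ofReal_le_ofReal (Real.one_le_rpow one_le_two hp0.le)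
  have hlim : ν (upperBox d (1 / 2)) < M := by
    rw [measure_upperBox h.homogeneous (by norm_num), h.measure_upperBox_one, mul_one, hM,
      ENNReal.ofReal_lt_ofReal_iff (by positivity), one_div, Real.inv_rpow zero_le_two,
      Real.rpow_neg zero_le_two, inv_inv]
    exact Real.rpow_lt_rpow_of_exponent_lt one_lt_two hp
  obtain ⟨x₀, hx₀⟩ := eventually_atTop.1
    ((eventually_gt_atTop 0).and ((h.tendsto_upperBox one_half_pos).eventually_lt_const hlim))
  have hhalf : ∀ x, x₀ ≤ x → G (x * (1 / 2)) ≤ M * G x := fun x hx =>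
    (ENNReal.div_le_iff (hG0 x) (hGt x)).1 (hx₀ x hx).2.le
  -- `K` is paid when halving crosses `x₀`: below it only `G ≤ 1 = K * G x₀` is available.
  set K : ℝ≥0∞ := (G x₀)⁻¹ with hK
  have hK1 : 1 ≤ K := ENNReal.one_le_inv.2 prob_le_one
  have hpow : ∀ n : ℕ, ∀ x, x₀ ≤ x → G (x * (1 / 2) ^ n) ≤ K * M ^ n * G x := by
    intro n
    induction n with
    | zero =>
      intro x _
      simpa using mul_le_mul_left hK1 (G x)
    | succ n ih =>
      intro x hx
      rcases le_or_gt x₀ (x * (1 / 2)) with hle | hlt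
      · calc G (x * (1 / 2) ^ (n + 1)) = G (x * (1 / 2) * (1 / 2) ^ n) := by ring_nf
          _ ≤ K * M ^ n * G (x * (1 / 2)) := ih _ hle
          _ ≤ K * M ^ n * (M * G x) := by gcongr; exact hhalf x hx
          _ = K * M ^ (n + 1) * G x := by ring
      · calc G (x * (1 / 2) ^ (n + 1)) ≤ 1 := prob_le_one
          _ = K * G x₀ := (ENNReal.inv_mul_cancel (hG0 _) (hGt _)).symm
          _ ≤ K * (M * G x) := by
            gcongr
            exact (hanti hlt.le).trans (hhalf x hx)
          _ ≤ K * (M ^ (n + 1) * G x) := by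
            gcongr
            exact le_self_pow hM1 n.succ_ne_zero
          _ = K * M ^ (n + 1) * G x := by ring
  refine ⟨K * M, ENNReal.mul_ne_top (ENNReal.inv_ne_top.2 (hG0 _)) ENNReal.ofReal_ne_top, x₀,
    (hx₀ x₀ le_rfl).1, fun x hx s hs => ?_⟩
  have hx0 : 0 < x := (hx₀ x hx).1
  rw [ENNReal.div_le_iff (hG0 x) (hGt x)]
  change G (x * s) ≤ _ * G x
  rcases le_or_gt 1 s with h1 | h1
  · calc G (x * s) ≤ 1 * 1 * 1 * G x := by
          rw [one_mul, one_mul, one_mul]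
          exact hanti (le_mul_of_one_le_right hx0.le h1)
      _ ≤ K * M * (1 + ENNReal.ofReal (s ^ (-p))) * G x := by
          gcongr
          exact le_self_add
  -- With `2^(-(n+1)) < s ≤ 2^(-n)`, `n` halvings cost at most `s^(-p)`; the extra one is the factor
  -- `M` in the constant.
  · obtain ⟨n, hn1, hn2⟩ := exists_nat_pow_near_of_lt_one hs h1.le
      (by norm_num : (0 : ℝ) < 1 / 2) (by norm_num)
    have hMn : M ^ n ≤ ENNReal.ofReal (s ^ (-p)) := by
      rw [hM, ← ENNReal.ofReal_pow (by positivity)]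
      refine ENNReal.ofReal_le_ofReal ?_
      rw [← Real.rpow_natCast, ← Real.rpow_mul zero_le_two, mul_comm, Real.rpow_mul zero_le_two,
        Real.rpow_natCast, Real.rpow_neg hs.le, ← Real.inv_rpow hs.le]
      refine Real.rpow_le_rpow (by positivity) ?_ hp0.le
      rw [le_inv_comm₀ (by positivity) hs, ← inv_pow, ← one_div]
      exact hn2
    calc G (x * s) ≤ G (x * (1 / 2) ^ (n + 1)) :=
          hanti (mul_le_mul_of_nonneg_left hn1.le hx0.le)
      _ ≤ K * M ^ (n + 1) * G x := hpow _ x hx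
      _ = K * M * M ^ n * G x := by ring
      _ ≤ K * M * (1 + ENNReal.ofReal (s ^ (-p))) * G x := by
          gcongr
          exact hMn.trans le_add_self

end RegularVariation

/-! ### Averaging over the random matrix. -/

section RandomMatrix

variable {Ω : Type*} [MeasurableSpace Ω] {P : Measure Ω} {d : ℕ}
  {Z : Ω → Fin d → ℝ} {A : Ω → Matrix (Fin d) (Fin d) ℝ} {α : ℝ} {ν : Measure (Fin d → ℝ)}

lemma measurable_measure_preimage_mulVec (hA : Measurable A) (μ : Measure (Fin d → ℝ)) [SFinite μ]
    {B : Set (Fin d → ℝ)} (hB : MeasurableSet B) :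
    Measurable fun ω => μ ((fun z => A ω *ᵥ z) ⁻¹' B) :=
  (measurable_measure_prodMk_left (ν := μ) (measurable_mulVec_prod hB)).comp hA

/-- Tonelli shows that the mean preimage is a genuine measure; for `μ` the law of `Z`, independence
makes it the law of `A Z`. -/
lemma meanPreimage_eq_map_prod (hA : Measurable A) (μ : Measure (Fin d → ℝ)) [SFinite μ]
    {B : Set (Fin d → ℝ)} (hB : MeasurableSet B) :
    ((P.map A).prod μ).map (fun p => p.1 *ᵥ p.2) B = meanPreimage P A μ B := by
  rw [Measure.map_apply measurable_mulVec_prod hB,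
    Measure.prod_apply (measurable_mulVec_prod hB),
    lintegral_map (measurable_measure_prodMk_left (measurable_mulVec_prod hB)) hA]
  rfl

lemma measure_mulVec_mem [IsProbabilityMeasure P] (hZ : Measurable Z) (hA : Measurable A)
    (hindep : IndepFun A Z P)
    {B : Set (Fin d → ℝ)} (hB : MeasurableSet B) :
    P {ω | A ω *ᵥ Z ω ∈ B} = meanPreimage P A (P.map Z) B := by
  have := Measure.isProbabilityMeasure_map hZ.aemeasurable (μ := P)
  rw [← meanPreimage_eq_map_prod hA _ hB, ← (indepFun_iff_map_prod_eq_prod_map_map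
    hA.aemeasurable hZ.aemeasurable).1 hindep, Measure.map_map measurable_mulVec_prod
    (hA.prodMk hZ), Measure.map_apply (measurable_mulVec_prod.comp (hA.prodMk hZ)) hB]
  rfl

lemma ae_tau_ne_top [Nonempty (Fin d)] (hA : Measurable A) {p : ℝ} (hp : 0 < p)
    (hmom : ∫⁻ ω, tau (A ω) ^ p ∂P < ∞) : ∀ᵐ ω ∂P, tau (A ω) ≠ ∞ := by
  filter_upwards [ae_lt_top ((measurable_tau.comp hA).pow_const p) hmom.ne] with ω hω htop
  simp [htop, ENNReal.top_rpow_of_pos hp] at hω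

lemma ofReal_div_tau_rpow {B : Matrix (Fin d) (Fin d) ℝ} (h : 0 < tau B) (hfin : tau B ≠ ∞)
    {ε : ℝ} (hε : 0 < ε) (p : ℝ) :
    ENNReal.ofReal ((ε / (tau B).toReal) ^ (-p)) = ENNReal.ofReal (ε ^ (-p)) * tau B ^ p := by
  have hT := ENNReal.toReal_pos h.ne' hfin
  rw [Real.div_rpow hε.le hT.le, Real.rpow_neg hT.le, div_inv_eq_mul,
    ENNReal.ofReal_mul (by positivity), ← ENNReal.ofReal_rpow_of_pos hT, ENNReal.ofReal_toReal hfin]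

lemma lintegral_potter_ne_top [IsProbabilityMeasure P] {p : ℝ}
    (hmom : ∫⁻ ω, tau (A ω) ^ p ∂P < ∞) {C c : ℝ≥0∞}
    (hC : C ≠ ∞) (hc : c ≠ ∞) : ∫⁻ ω, C * (1 + c * tau (A ω) ^ p) ∂P ≠ ∞ := by
  rw [lintegral_const_mul' _ _ hC, lintegral_add_left measurable_const, lintegral_const_mul' _ _ hc]
  refine ENNReal.mul_ne_top hC (ENNReal.add_ne_top.2 ⟨by simp, ENNReal.mul_ne_top hc hmom.ne⟩)

variable [Nonempty (Fin d)]

/-- The Potter bound holds for the ratios before the limit, so it passes to `ν` of the box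
containing the preimage. -/
lemma meanPreimage_lt_top [IsProbabilityMeasure P] (hA : Measurable A) (h : IsRegularlyVarying P Z α ν)
    (hpos : ∀ᵐ ω ∂P, 0 < tau (A ω)) {p : ℝ} (hp : α < p)
    (hmom : ∫⁻ ω, tau (A ω) ^ p ∂P < ∞) {B : Set (Fin d → ℝ)} {ε : ℝ} (hε : 0 < ε)
    (hB : B ⊆ upperBox d ε) : meanPreimage P A ν B < ∞ := by
  obtain ⟨C, hC, x₀, -, hpot⟩ := h.exists_potter_bound hp
  refine (lintegral_mono_ae ?_).trans_lt (lintegral_potter_ne_top (P := P) hmom hC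
    (ENNReal.ofReal_ne_top (r := ε ^ (-p)))).lt_top
  filter_upwards [hpos, ae_tau_ne_top hA (h.index_pos.trans hp) hmom] with ω h0 hfin
  have hs : 0 < ε / (tau (A ω)).toReal := div_pos hε (ENNReal.toReal_pos h0.ne' hfin)
  rw [← ofReal_div_tau_rpow h0 hfin hε]
  refine (measure_mono (preimage_mulVec_subset_upperBox h0 hfin hε hB)).trans
    (le_of_tendsto (h.tendsto_upperBox hs) ?_)
  filter_upwards [eventually_ge_atTop x₀] with x hx using hpot x hx _ hs

lemma lintegral_measure_frontier (hpos : ∀ᵐ ω ∂P, 0 < tau (A ω)) (hfin : ∀ᵐ ω ∂P, tau (A ω) ≠ ∞)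
    (B : Set (Fin d → ℝ)) :
    ∫⁻ ω, ν (frontier ((fun z => A ω *ᵥ z) ⁻¹' B)) ∂P = meanPreimage P A ν (frontier B) := by
  refine lintegral_congr_ae ?_
  filter_upwards [hpos, hfin] with ω h0 h1
  rw [frontier_preimage_mulVec h0 h1]

/-- The multivariate Breiman lemma: convergence of the normalized tail of `A Z`. -/
lemma tendsto_measure_mulVec [IsProbabilityMeasure P] (hZ : Measurable Z) (hA : Measurable A)
    (h : IsRegularlyVarying P Z α ν) (hindep : IndepFun A Z P)
    (hpos : ∀ᵐ ω ∂P, 0 < tau (A ω)) {p : ℝ} (hp : α < p)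
    (hmom : ∫⁻ ω, tau (A ω) ^ p ∂P < ∞) {B : Set (Fin d → ℝ)} (hBm : MeasurableSet B) {ε : ℝ}
    (hε : 0 < ε) (hB : B ⊆ upperBox d ε) (hfr : meanPreimage P A ν (frontier B) = 0) :
    Tendsto (fun x : ℝ => P {ω | A ω *ᵥ Z ω ∈ x • B} / P {ω | x < minCoord (Z ω)}) atTop
      (𝓝 (meanPreimage P A ν B)) := by
  have := sigmaFinite_of_upperBox h.compl_cone h.finite_upperBox
  have hprob := Measure.isProbabilityMeasure_map hZ.aemeasurable (μ := P)
  have hfin := ae_tau_ne_top hA (h.index_pos.trans hp) hmom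
  obtain ⟨C, hC, x₀, hx₀, hpot⟩ := h.exists_potter_bound hp
  have hmeas : ∀ x : ℝ, 0 < x → MeasurableSet (x • B) := fun x hx => hBm.const_smul₀ x
  have hZB : ∀ x : ℝ, 0 < x → ∀ ω, P.map Z ((fun z => A ω *ᵥ z) ⁻¹' (x • B)) =
      P {ω' | Z ω' ∈ x • ((fun z => A ω *ᵥ z) ⁻¹' B)} := by
    intro x hx ω
    rw [Measure.map_apply hZ (measurable_mulVec _ (hmeas x hx)), preimage_mulVec_smul _ hx.ne']
    rfl
  have hmain : Tendsto (fun x : ℝ => ∫⁻ ω, P.map Z ((fun z => A ω *ᵥ z) ⁻¹' (x • B)) /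
      P {ω | x < minCoord (Z ω)} ∂P) atTop (𝓝 (meanPreimage P A ν B)) := by
    refine tendsto_lintegral_filter_of_dominated_convergence
      (fun ω => C * (1 + ENNReal.ofReal (ε ^ (-p)) * tau (A ω) ^ p)) ?_ ?_
      (lintegral_potter_ne_top hmom hC ENNReal.ofReal_ne_top) ?_
    · filter_upwards [eventually_gt_atTop 0] with x hx
      exact ((measurable_measure_preimage_mulVec hA _ (hmeas x hx)).div_const _)
    · filter_upwards [eventually_ge_atTop x₀] with x hx
      have hx0 := hx₀.trans_le hx
      filter_upwards [hpos, hfin] with ω h0 h1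
      have hs : 0 < ε / (tau (A ω)).toReal := div_pos hε (ENNReal.toReal_pos h0.ne' h1)
      rw [← ofReal_div_tau_rpow h0 h1 hε, hZB x hx0]
      refine le_trans ?_ (hpot x hx _ hs)
      rw [← setOf_mem_smul_upperBox Z hx0]
      refine ENNReal.div_le_div_right (measure_mono fun ω' hω' => ?_) _
      exact Set.smul_set_mono (preimage_mulVec_subset_upperBox h0 h1 hε hB) hω'
    · have hae := (lintegral_eq_zero_iff (measurable_measure_preimage_mulVec hA ν
        isClosed_frontier.measurableSet)).1 hfr
      filter_upwards [hpos, hfin, hae] with ω h0 h1 h2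
      have hs : 0 < ε / (tau (A ω)).toReal := div_pos hε (ENNReal.toReal_pos h0.ne' h1)
      have hsub := preimage_mulVec_subset_upperBox h0 h1 hε hB
      refine (h.tendsto _ (measurable_mulVec (A ω) hBm) (hsub.trans (upperBox_subset hs.le))
        (boundedAwayFromBoundary_of_subset_upperBox hs hsub) ?_).congr' ?_
      · rw [frontier_preimage_mulVec h0 h1]
        exact h2
      · filter_upwards [eventually_gt_atTop 0] with x hx
        rw [hZB x hx]
  refine hmain.congr' ?_
  filter_upwards [eventually_gt_atTop 0] with x hx
  rw [measure_mulVec_mem hZ hA hindep (hmeas x hx)]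
  simp only [div_eq_mul_inv, meanPreimage]
  rw [lintegral_mul_const' _ _ (ENNReal.inv_ne_top.2 (h.measure_lt_ne_zero x))]

lemma meanPreimage_smul (hfin : ∀ᵐ ω ∂P, tau (A ω) ≠ ∞) (hpos : ∀ᵐ ω ∂P, 0 < tau (A ω))
    (hhom : ∀ t : ℝ, 0 < t → ∀ B : Set (Fin d → ℝ), MeasurableSet B →
      B ⊆ cone d → ν (t • B) = ENNReal.ofReal (t ^ (-α)) * ν B) {t : ℝ} (ht : 0 < t)
    {B : Set (Fin d → ℝ)} (hBm : MeasurableSet B) (hB : B ⊆ cone d) :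
    meanPreimage P A ν (t • B) = ENNReal.ofReal (t ^ (-α)) * meanPreimage P A ν B := by
  rw [meanPreimage, meanPreimage, ← lintegral_const_mul' _ _ ENNReal.ofReal_ne_top]
  refine lintegral_congr_ae ?_
  filter_upwards [hpos, hfin] with ω h0 h1
  rw [preimage_mulVec_smul _ ht.ne', hhom t ht _ (measurable_mulVec _ hBm)
    fun z hz => mem_cone_of_mulVec_mem_cone h0 h1 (hB hz)]

/-- The normalized mean of the preimage measures is the limit measure of `A Z`. -/
lemma exists_isRegularlyVarying_mulVec [IsProbabilityMeasure P] (hZ : Measurable Z) (hA : Measurable A)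
    (h : IsRegularlyVarying P Z α ν) (hindep : IndepFun A Z P)
    (hpos : ∀ᵐ ω ∂P, 0 < tau (A ω)) {p : ℝ} (hp : α < p)
    (hmom : ∫⁻ ω, tau (A ω) ^ p ∂P < ∞) (hc : 0 < meanPreimage P A ν (upperBox d 1)) :
    ∃ ν' : Measure (Fin d → ℝ),
      (∀ B : Set (Fin d → ℝ), MeasurableSet B → B ⊆ cone d →
        ν' B = meanPreimage P A ν B / meanPreimage P A ν (upperBox d 1)) ∧
      IsRegularlyVarying P (fun ω => A ω *ᵥ Z ω) α ν' := by
  have := sigmaFinite_of_upperBox h.compl_cone h.finite_upperBox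
  have hfin := ae_tau_ne_top hA (h.index_pos.trans hp) hmom
  set c := meanPreimage P A ν (upperBox d 1)
  have hct : c ≠ ∞ := (meanPreimage_lt_top hA h hpos hp hmom one_pos subset_rfl).ne
  set ν' : Measure (Fin d → ℝ) :=
    -- The pushforward may charge the complement of the cone on a null event of matrices or through
    -- points mapped outside; restricting removes this.
    c⁻¹ • (((P.map A).prod ν).map fun p => p.1 *ᵥ p.2).restrict (cone d)
  have hν' : ∀ B : Set (Fin d → ℝ), MeasurableSet B → B ⊆ cone d →
      ν' B = meanPreimage P A ν B / c := by
    intro B hBm hB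
    rw [Measure.smul_apply, Measure.restrict_apply hBm, Set.inter_eq_left.2 hB,
      meanPreimage_eq_map_prod hA ν hBm, smul_eq_mul, mul_comm, div_eq_mul_inv]
  have hbox : ∀ s : ℝ, 0 < s → ν' (upperBox d s) < ∞ := by
    intro s hs
    rw [hν' _ (isOpen_upperBox s).measurableSet (upperBox_subset hs.le)]
    exact ENNReal.div_lt_top (meanPreimage_lt_top hA h hpos hp hmom hs subset_rfl).ne hc.ne'
  have hhom : ∀ t : ℝ, 0 < t → ∀ B : Set (Fin d → ℝ), MeasurableSet B → B ⊆ cone d →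
      ν' (t • B) = ENNReal.ofReal (t ^ (-α)) * ν' B := by
    intro t ht B hBm hB
    have htB : t • B ⊆ cone d := by
      have := Set.smul_set_mono (a := t) hB
      rwa [cone_eq_upperBox, smul_upperBox ht, mul_zero] at this
    rw [hν' _ (hBm.const_smul₀ t) htB, hν' _ hBm hB,
      meanPreimage_smul hfin hpos h.homogeneous ht hBm hB, mul_div_assoc]
  have hfr : ∀ B : Set (Fin d → ℝ), ∀ ε, 0 < ε → B ⊆ upperBox d ε → ν' (frontier B) = 0 →
      meanPreimage P A ν (frontier B) = 0 := by
    intro B ε hε hB h0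
    rw [hν' _ isClosed_frontier.measurableSet (frontier_subset_cone hε hB),
      ENNReal.div_eq_zero_iff] at h0
    -- A quotient in `ℝ≥0∞` also vanishes when its denominator is infinite, which `hct` excludes.
    exact h0.resolve_right hct
  have hden : Tendsto (fun x : ℝ => P {ω | x < minCoord (A ω *ᵥ Z ω)} / P {ω | x < minCoord (Z ω)})
      atTop (𝓝 c) := by
    refine (tendsto_measure_mulVec hZ hA h hindep hpos hp hmom (isOpen_upperBox 1).measurableSet
      one_pos subset_rfl (hfr _ 1 one_pos subset_rfl
        (measure_frontier_upperBox hbox hhom one_pos))).congr' ?_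
    filter_upwards [eventually_gt_atTop 0] with x hx
    rw [setOf_mem_smul_upperBox (fun ω => A ω *ᵥ Z ω) hx, mul_one]
  refine ⟨ν', hν', ?_, ?_, hbox, ?_, h.index_pos, hhom⟩
  · simp [ν', Measure.restrict_apply isOpen_cone.measurableSet.compl]
  · intro h0
    have := hν' _ (isOpen_upperBox 1).measurableSet (upperBox_subset zero_le_one)
    rw [h0, ENNReal.div_self hc.ne' hct] at this
    simp at this
  · intro B hBm hBc hB h0
    obtain ⟨ε, hε, hBε⟩ := hB.exists_subset_upperBox hBc
    rw [hν' B hBm hBc]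
    -- Both limits are normalized by the tail of `min Z`, which cancels in their quotient.
    refine (ENNReal.Tendsto.div (tendsto_measure_mulVec hZ hA h hindep hpos hp hmom hBm hε hBε
      (hfr B ε hε hBε h0)) (Or.inr hc.ne') hden (Or.inl hct)).congr fun x => ?_
    rw [div_eq_mul_inv (P _) (P {ω | x < minCoord (Z ω)}),
      div_eq_mul_inv (P {ω | x < minCoord (A ω *ᵥ Z ω)}) (P {ω | x < minCoord (Z ω)}),
      ENNReal.mul_div_mul_right _ _ (ENNReal.inv_ne_zero.2 (measure_ne_top _ _))
        (ENNReal.inv_ne_top.2 (h.measure_lt_ne_zero x))]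

end RandomMatrix

end ConeRV

theorem mainTheorem1 {Ω : Type*} [MeasurableSpace Ω] (P : Measure Ω) [IsProbabilityMeasure P]
    (d : ℕ) (hd : 1 ≤ d)
    (Z : Ω → Fin d → ℝ) (hZ : Measurable Z)
    (A : Ω → Matrix (Fin d) (Fin d) ℝ) (hA : Measurable A)
    (α : ℝ) (ν : Measure (Fin d → ℝ))
    (hreg : ConeRV.IsRegularlyVarying P Z α ν)
    (hindep : IndepFun A Z P)
    (hpos : ∀ᵐ ω ∂P, 0 < ConeRV.tau (A ω))
    (δ : ℝ) (hδ : 0 < δ)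
    (hmom : ∫⁻ ω, ConeRV.tau (A ω) ^ (α + δ) ∂P < ∞) :
    (∀ B : Set (Fin d → ℝ), MeasurableSet B → B ⊆ ConeRV.cone d →
      ConeRV.BoundedAwayFromBoundary B →
      ∫⁻ ω, ν (frontier ((fun z => A ω *ᵥ z) ⁻¹' B)) ∂P = 0 →
      Tendsto
          (fun x : ℝ => P {ω | A ω *ᵥ Z ω ∈ x • B} / P {ω | x < ConeRV.minCoord (Z ω)})
          atTop (𝓝 (ConeRV.meanPreimage P A ν B)) ∧
        ConeRV.meanPreimage P A ν B < ∞) ∧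
    (0 < ConeRV.meanPreimage P A ν (ConeRV.upperBox d 1) →
      ∃ ν' : Measure (Fin d → ℝ),
        (∀ B : Set (Fin d → ℝ), MeasurableSet B → B ⊆ ConeRV.cone d →
          ν' B = ConeRV.meanPreimage P A ν B /
            ConeRV.meanPreimage P A ν (ConeRV.upperBox d 1)) ∧
        ConeRV.IsRegularlyVarying P (fun ω => A ω *ᵥ Z ω) α ν') := by
  have : Nonempty (Fin d) := ⟨⟨0, hd⟩⟩
  have hp : α < α + δ := lt_add_of_pos_right α hδ
  refine ⟨fun B hBm hBc hB hfr => ?_,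
    ConeRV.exists_isRegularlyVarying_mulVec hZ hA hreg hindep hpos hp hmom⟩
  obtain ⟨ε, hε, hBε⟩ := hB.exists_subset_upperBox hBc
  rw [ConeRV.lintegral_measure_frontier hpos
    (ConeRV.ae_tau_ne_top hA (hreg.index_pos.trans hp) hmom)] at hfr
  exact ⟨ConeRV.tendsto_measure_mulVec hZ hA hreg hindep hpos hp hmom hBm hε hBε hfr,
    ConeRV.meanPreimage_lt_top hA hreg hpos hp hmom hε hBε⟩
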